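/- For a finite group $G$ let $\mathrm{Irr}(G)$ be the set of its complex irreducible characters. The kernel of $\chi\in\mathrm{Irr}(G)$ is $\ker\chi=\{g\in G\mid \chi(g)=\chi(1)\}$ and its codegree is $\mathrm{cod}\,\chi=|G:\ker\chi|/\chi(1)$. Let $\mathrm{Cod}(G)=\{\mathrm{cod}\,\chi\mid\chi\in\mathrm{Irr}(G)\}$, let $m_G(d)$ be the number of $\chi\in\mathrm{Irr}(G)$ with $\mathrm{cod}\,\chi=d$, and let $C(G)=\{(d,m_G(d))\mid d\in\mathrm{Cod}(G)\}$ be the group pseudo-algebra of $G$. **Theorem.** There are a prime $p$, a finite abelian $p$-group $A$ and a finite group $G$ such that $C(G)=C(A)$, $G\not\cong A$, and moreover $|G|\neq|A|$; so groups with the same pseudo-algebra can have different orders. Concretely, let $A=C_8\times C_2\times C_2$, a $2$-group of order $32$. Then $C(A)=\{(1,1),(2,7),(4,8),(8,16)\}$. Let $G$ be given by generators $x,y,z,c,u,v$ and the relations $$yx=xyc,\quad zx=xzu,\quad zy=yzv,\quad c^4=u^2=v^2=1,\quad x^{-1}cx=y^{-1}cy=c^{-1},\quad cz=zc,$$ $u$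 and $v$ commute with all generators, and $(x^2,y^2,z^2)$ is one of the ten triples $$(v,1,v),\ (1,v,v),\ (v,u,v),\ (1,uv,v),\ (c^2,v,v),\ (c^2v,u,v),\ (c^2,uv,v),\ (c^2,v,u),\ (c^2uv,1,u),\ (c^2,c^2uv,v).$$ Then, for each of the ten choices, $|G|=128$, $C(G)=C(A)$ and $G\not\cong A$. (For identification only: the groups SmallGroup(128,755), SmallGroup(128,756) and SmallGroup(128,773) of the GAP library are among these ten.) -/

import Mathlib

/-- The set `Irr(G)` of the complex irreducible characters of `G`, as functions on `G`.
Every finite-dimensional complex representation is isomorphic to one on some `ℂⁿ`. -/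
def IrrChar (G : Type*) [Group G] : Set (G → ℂ) :=
  {χ | ∃ (n : ℕ) (ρ : Representation ℂ G (Fin n → ℂ)), ρ.IsIrreducible ∧ ρ.character = χ}

/-- The kernel `{g | χ(g) = χ(1)}` of a character `χ`. -/
def charKer {G : Type*} [Group G] (χ : G → ℂ) : Set G :=
  {g | χ g = χ 1}

/-- The codegree `|G : ker χ| / χ(1)` of a character `χ` of a finite group `G`,
where `|G : ker χ| = |G| / |ker χ|`. -/
noncomputable def codegree {G : Type*} [Group G] (χ : G → ℂ) : ℂ :=
  ((Nat.card G : ℂ) / (Nat.card (charKer χ) : ℂ)) / χ 1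

/-- The set `Cod(G)` of the codegrees of the irreducible characters of `G`. -/
def Cod (G : Type*) [Group G] : Set ℂ :=
  codegree '' IrrChar G

/-- `m_G(d)`: the number of irreducible characters of `G` of codegree `d`. -/
noncomputable def codMult (G : Type*) [Group G] (d : ℂ) : ℕ :=
  {χ ∈ IrrChar G | codegree χ = d}.ncard

/-- The group pseudo-algebra `C(G) = {(d, m_G(d)) | d ∈ Cod(G)}` of a finite group `G`. -/
def pseudoAlgebra (G : Type*) [Group G] : Set (ℂ × ℕ) :=
  {q | ∃ d ∈ Cod G, q = (d, codMult G d)}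

/-- The abelian group `C₈ × C₂ × C₂`. -/
abbrev AbGroup : Type :=
  Multiplicative (ZMod 8) × Multiplicative (ZMod 2) × Multiplicative (ZMod 2)

namespace Pres

/-- The six generators `x, y, z, c, u, v` (in this order) of the free group. -/
abbrev F : Type := FreeGroup (Fin 6)

def x : F := FreeGroup.of 0
def y : F := FreeGroup.of 1
def z : F := FreeGroup.of 2
def c : F := FreeGroup.of 3
def u : F := FreeGroup.of 4
def v : F := FreeGroup.of 5

/-- The relators of
`yx = xyc, zx = xzu, zy = yzv, c⁴ = u² = v² = 1, x⁻¹cx = y⁻¹cy = c⁻¹, cz = zc`,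
`u` and `v` commute with all generators, and `x² = r, y² = s, z² = t`.
The elements of the presented group are the words `xⁱ yʲ zᵏ cˡ uᵐ vⁿ`
with `i, j, k, m, n ∈ {0, 1}` and `l ∈ {0, 1, 2, 3}`. -/
def rels (r s t : F) : Set F :=
  {(y * x) * (x * y * c)⁻¹, (z * x) * (x * z * u)⁻¹, (z * y) * (y * z * v)⁻¹,
    c ^ 4, u ^ 2, v ^ 2,
    (x⁻¹ * c * x) * c, (y⁻¹ * c * y) * c, (c * z) * (z * c)⁻¹,
    (u * x) * (x * u)⁻¹, (u * y) * (y * u)⁻¹, (u * z) * (z * u)⁻¹, (u * c) * (c * u)⁻¹,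
    (v * x) * (x * v)⁻¹, (v * y) * (y * v)⁻¹, (v * z) * (z * v)⁻¹, (v * c) * (c * v)⁻¹,
    (u * v) * (v * u)⁻¹,
    x ^ 2 * r⁻¹, y ^ 2 * s⁻¹, z ^ 2 * t⁻¹}

/-- The ten choices of the triple of squares `(x², y², z²)`. -/
def squares : Fin 10 → F × F × F :=
  ![(v, 1, v),
    (1, v, v),
    (v, u, v),
    (1, u * v, v),
    (c ^ 2, v, v),
    (c ^ 2 * v, u, v),
    (c ^ 2, u * v, v),
    (c ^ 2, v, u),
    (c ^ 2 * u * v, 1, u),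
    (c ^ 2, c ^ 2 * u * v, v)]

end Pres

/-- Ten groups of order 128, given by generators and relations. -/
abbrev ExGroup (i : Fin 10) : Type :=
  PresentedGroup (Pres.rels (Pres.squares i).1 (Pres.squares i).2.1 (Pres.squares i).2.2)

/-! For each of the ten choices, 32 explicit representations are written down, of degrees 1 (8
times), 2 (22 times) and 4 (twice), so that the squares of the degrees sum to 128. If the characters
of a family, weighted by their degrees, sum to the regular character, then `∑ j, n j * dim Hom(σ, ρ
j) = dim σ` for every `σ`. This identity alone forces the members to be irreducible, pairwise
inequivalent and exhaustive, so the pseudo-algebra can be read off from degrees and kernel orders.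

All representations are monomial over the eighth roots of unity. A vanishing trace then follows from
the cancellation of `ζ ^ e` against `ζ ^ (e + 4)`, and a trivial action is recognized from the
trace; both become finite computations with integers.

The order of `G` comes from the normal forms `xⁱ yʲ zᵏ cˡ uᵐ vⁿ`. They are stable under left
multiplication by the generators, which gives `|G| ≤ 128`. They are distinct because the same 32
representations have no common kernel among them. For `A`, the codegree of a linear character is its
order. The pseudo-algebras agree while 128 ≠ 32. -/

/-! ### Families whose weighted character sum is regular. -/

section RegularFamily

open Representation Module

variable {G : Type*} [Group G] [Finite G] {ι : Type*} [Fintype ι] {n : ι → ℕ}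
  {ρ : ∀ j, Representation ℂ G (Fin (n j) → ℂ)}

/-- If `∑ j, n j • χ j` is the regular character, then `∑ j, n j * dim Hom(W, ρ j) = dim W`. -/
theorem sum_mul_finrank_intertwiningMap [DecidableEq G]
    (h : ∀ g, ∑ j, (n j : ℂ) * (ρ j).character g = if g = 1 then (Nat.card G : ℂ) else 0)
    {W : Type*} [AddCommGroup W] [Module ℂ W] [FiniteDimensional ℂ W]
    (σ : Representation ℂ G W) :
    ∑ j, n j * finrank ℂ (IntertwiningMap σ (ρ j)) = finrank ℂ W := by
  have := Fintype.ofFinite G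
  have hG : (Nat.card G : ℂ) ≠ 0 := by exact_mod_cast Nat.card_pos.ne'
  have := invertibleOfNonzero hG
  apply Nat.cast_injective (R := ℂ)
  push_cast
  simp_rw [← card_inv_mul_sum_char_mul_char_eq_finrank σ]
  calc ∑ j, (n j : ℂ) * ((Nat.card G : ℂ)⁻¹ * ∑ g, (ρ j).character g * σ.character g⁻¹)
      = (Nat.card G : ℂ)⁻¹ * ∑ g, (∑ j, (n j : ℂ) * (ρ j).character g) * σ.character g⁻¹ := by
        simp_rw [Finset.sum_mul, Finset.mul_sum]
        rw [Finset.sum_comm]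
        refine Finset.sum_congr rfl fun _ _ ↦ Finset.sum_congr rfl fun _ _ ↦ by ring
    _ = finrank ℂ W := by
        simp [h]

/-- The inclusion of a nonzero subrepresentation `σ` makes `Hom(σ, ρ j)` nonzero, so the dimension
identity gives `dim σ ≥ n j`. -/
theorem isIrreducible_of_regular [DecidableEq G] (hn : ∀ j, n j ≠ 0)
    (h : ∀ g, ∑ j, (n j : ℂ) * (ρ j).character g = if g = 1 then (Nat.card G : ℂ) else 0)
    (j : ι) : (ρ j).IsIrreducible := by
  have : Nonempty (Fin (n j)) := ⟨⟨0, Nat.pos_of_ne_zero (hn j)⟩⟩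
  have hnt : Nontrivial (Subrepresentation (ρ j)) := by
    refine ⟨⊥, ⊤, fun e ↦ ?_⟩
    have e' : (⊥ : Submodule ℂ (Fin (n j) → ℂ)) = ⊤ := congrArg Subrepresentation.toSubmodule e
    exact bot_ne_top e'
  refine { eq_bot_or_eq_top := fun σ ↦ ?_ }
  by_cases hσ : σ.toSubmodule = ⊥
  · exact Or.inl (Subrepresentation.toSubmodule_injective hσ)
  refine Or.inr (Subrepresentation.toSubmodule_injective ?_)
  let f : IntertwiningMap σ.toRepresentation (ρ j) := ⟨σ.toSubmodule.subtype, fun g ↦ rfl⟩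
  have hf : f ≠ 0 := by
    intro e
    apply hσ
    rw [eq_bot_iff]
    intro v hv
    have : f ⟨v, hv⟩ = 0 := by rw [e]; rfl
    exact this
  have := nontrivial_of_ne f 0 hf
  have hpos : 0 < finrank ℂ (IntertwiningMap σ.toRepresentation (ρ j)) :=
    finrank_pos_iff.mpr inferInstance
  have hsum := sum_mul_finrank_intertwiningMap h σ.toRepresentation
  have hle := Finset.single_le_sum (s := Finset.univ) (a := j)
    (f := fun j ↦ n j * finrank ℂ (IntertwiningMap σ.toRepresentation (ρ j)))
    (fun _ _ ↦ Nat.zero_le _) (Finset.mem_univ j)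
  rw [hsum] at hle
  refine Submodule.eq_top_of_finrank_eq (le_antisymm (Submodule.finrank_le _) ?_)
  rw [finrank_fin_fun]
  exact (Nat.le_mul_of_pos_right _ hpos).trans hle

/-- If two labels `j ≠ k` shared a character, both Hom spaces out of `ρ j` would have dimension 1,
and the identity for `σ = ρ j` would give `n j ≥ n j + n k`. -/
theorem character_injective_of_regular [DecidableEq G] (hn : ∀ j, n j ≠ 0)
    (h : ∀ g, ∑ j, (n j : ℂ) * (ρ j).character g = if g = 1 then (Nat.card G : ℂ) else 0) :
    Function.Injective fun j ↦ (ρ j).character := by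
  classical
  intro j k hjk
  by_contra hne
  have := Fintype.ofFinite G
  have hG : (Nat.card G : ℂ) ≠ 0 := by exact_mod_cast Nat.card_pos.ne'
  have := invertibleOfNonzero hG
  have := isIrreducible_of_regular hn h j
  have h1 : finrank ℂ (IntertwiningMap (ρ j) (ρ j)) = 1 :=
    IsIrreducible.finrank_intertwiningMap_self (ρ j)
  have h2 : finrank ℂ (IntertwiningMap (ρ j) (ρ k)) = 1 := by
    rw [← h1]
    apply Nat.cast_injective (R := ℂ)
    rw [← card_inv_mul_sum_char_mul_char_eq_finrank, ← card_inv_mul_sum_char_mul_char_eq_finrank]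
    simp only at hjk
    rw [hjk]
  have hsum := sum_mul_finrank_intertwiningMap h (ρ j)
  have hle := Finset.sum_le_sum_of_subset (Finset.subset_univ {j, k})
    (f := fun l ↦ n l * finrank ℂ (IntertwiningMap (ρ j) (ρ l)))
  rw [hsum, Finset.sum_pair hne, h1, h2, finrank_fin_fun] at hle
  have := hn k
  omega

/-- An irreducible `σ` has positive dimension, hence a nonzero map to some `ρ j`, which is an
isomorphism by Schur's lemma. -/
theorem irrChar_eq_range_of_regular [DecidableEq G] (hn : ∀ j, n j ≠ 0)
    (h : ∀ g, ∑ j, (n j : ℂ) * (ρ j).character g = if g = 1 then (Nat.card G : ℂ) else 0) :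
    IrrChar G = Set.range fun j ↦ (ρ j).character := by
  ext χ
  constructor
  · rintro ⟨m, σ, hσ, rfl⟩
    have hsum := sum_mul_finrank_intertwiningMap h σ
    have hm : 0 < finrank ℂ (Fin m → ℂ) := by
      rw [finrank_pos_iff]
      by_contra hc
      rw [not_nontrivial_iff_subsingleton] at hc
      exact bot_ne_top (α := Subrepresentation σ)
        (Subrepresentation.toSubmodule_injective (Subsingleton.elim _ _))
    rw [← hsum] at hm
    obtain ⟨j, -, hj⟩ := Finset.exists_ne_zero_of_sum_ne_zero hm.ne'
    have := isIrreducible_of_regular hn h j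
    have : Nontrivial (IntertwiningMap σ (ρ j)) :=
      nontrivial_of_finrank_pos (R := ℂ) (Nat.pos_of_ne_zero (right_ne_zero_of_mul hj))
    obtain ⟨f, hf⟩ := exists_ne (0 : IntertwiningMap σ (ρ j))
    exact ⟨j, (char_iso (f.ofBijective
      ((IsIrreducible.bijective_or_eq_zero f).resolve_right hf))).symm⟩
  · rintro ⟨j, rfl⟩
    exact ⟨n j, ρ j, isIrreducible_of_regular hn h j, rfl⟩

/-- A family of representations whose characters sum up to the regular one computes the
pseudo-algebra. -/
theorem pseudoAlgebra_of_regular [DecidableEq G] (hn : ∀ j, n j ≠ 0)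
    (h : ∀ g, ∑ j, (n j : ℂ) * (ρ j).character g = if g = 1 then (Nat.card G : ℂ) else 0)
    (D : ι → ℕ)
    (hD : ∀ j, Nat.card (charKer (ρ j).character) * (n j * D j) = Nat.card G) :
    pseudoAlgebra G =
      {q | ∃ d ∈ Set.range D, q = ((d : ℂ), (Finset.univ.filter fun j ↦ D j = d).card)} := by
  have hcod : ∀ j, codegree (ρ j).character = D j := by
    intro j
    have hK : (Nat.card (charKer (ρ j).character) : ℂ) ≠ 0 := by
      have : Nonempty (charKer (ρ j).character) := ⟨1, rfl⟩
      exact_mod_cast Nat.card_pos.ne'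
    have hj : (n j : ℂ) ≠ 0 := by exact_mod_cast hn j
    rw [codegree, char_one, finrank_fin_fun, ← hD j]
    push_cast
    field_simp
  have hirr := irrChar_eq_range_of_regular hn h
  have hmult : ∀ d : ℕ, codMult G d = (Finset.univ.filter fun j ↦ D j = d).card := by
    intro d
    have : {χ ∈ IrrChar G | codegree χ = d} =
        (fun j ↦ (ρ j).character) '' (Finset.univ.filter fun j ↦ D j = d : Finset ι) := by
      ext χ
      simp only [hirr, Set.mem_ofPred_eq, Set.mem_range, Set.mem_image, Finset.coe_filter,
        Finset.mem_univ, true_and]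
      constructor
      · rintro ⟨⟨j, rfl⟩, hj⟩
        exact ⟨j, by rw [hcod] at hj; exact_mod_cast hj, rfl⟩
      · rintro ⟨j, hj, rfl⟩
        exact ⟨⟨j, rfl⟩, by rw [hcod, hj]⟩
    rw [codMult, this, Set.ncard_image_of_injective _ (character_injective_of_regular hn h),
      Set.ncard_coe_finset]
  ext q
  simp only [pseudoAlgebra, Cod, hirr, Set.mem_ofPred_eq, Set.mem_image, Set.mem_range]
  constructor
  · rintro ⟨_, ⟨_, ⟨j, rfl⟩, rfl⟩, rfl⟩
    exact ⟨D j, ⟨j, rfl⟩, by rw [hcod, hmult]⟩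
  · rintro ⟨_, ⟨j, rfl⟩, rfl⟩
    exact ⟨D j, ⟨_, ⟨j, rfl⟩, hcod j⟩, by rw [hmult]⟩

end RegularFamily

/-! ### Monomial matrices, their traces and integer codes. -/

/-- The monomial matrices with entries in the eighth roots of unity, whose rows and columns are
indexed by `ℤ/(a+1) × ℤ/(b+1)` and whose underlying permutation is a translation. -/
@[ext] structure Mono (a b : ℕ) where
  shift : Fin (a + 1) × Fin (b + 1)
  phase : Fin (a + 1) × Fin (b + 1) → ZMod 8

namespace Mono

open Module

variable {a b : ℕ}

instance : DecidableEq (Mono a b) := fun A B ↦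
  decidable_of_iff (A.shift = B.shift ∧ ∀ p, A.phase p = B.phase p)
    (by rw [Mono.ext_iff, funext_iff])

instance : One (Mono a b) := ⟨⟨0, fun _ ↦ 0⟩⟩

instance : Mul (Mono a b) :=
  ⟨fun A B ↦ ⟨A.shift + B.shift, fun p ↦ A.phase p + B.phase (p + A.shift)⟩⟩

instance : Inv (Mono a b) := ⟨fun A ↦ ⟨-A.shift, fun p ↦ -A.phase (p - A.shift)⟩⟩

@[simp] theorem shift_one : (1 : Mono a b).shift = 0 := rfl
@[simp] theorem phase_one (p) : (1 : Mono a b).phase p = 0 := rfl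
@[simp] theorem shift_mul (A B : Mono a b) : (A * B).shift = A.shift + B.shift := rfl
@[simp] theorem phase_mul (A B : Mono a b) (p) :
    (A * B).phase p = A.phase p + B.phase (p + A.shift) := rfl
@[simp] theorem shift_inv (A : Mono a b) : A⁻¹.shift = -A.shift := rfl
@[simp] theorem phase_inv (A : Mono a b) (p) : A⁻¹.phase p = -A.phase (p - A.shift) := rfl

instance : Group (Mono a b) :=
  Group.ofLeftAxioms
    (fun A B C ↦ by ext p <;> simp [add_assoc])
    (fun A ↦ by ext p <;> simp)
    (fun A ↦ by ext p <;> simp [sub_eq_add_neg])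

/-- The matrices in `Mono a b` acting on functions. -/
noncomputable def toEnd : Mono a b →* End ℂ (Fin (a + 1) × Fin (b + 1) → ℂ) where
  toFun A :=
    { toFun f p := ZMod.stdAddChar (A.phase p) * f (p + A.shift)
      map_add' f g := by ext p; simp [mul_add]
      map_smul' c f := by ext p; simp; ring }
  map_one' := by ext f p; simp
  map_mul' A B := by
    ext f p
    simp [AddChar.map_add_eq_mul, mul_assoc, add_assoc]

theorem toEnd_apply (A : Mono a b) (f p) :
    toEnd A f p = ZMod.stdAddChar (A.phase p) * f (p + A.shift) := rfl

theorem trace_toEnd (A : Mono a b) :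
    LinearMap.trace ℂ _ (toEnd A) =
      if A.shift = 0 then ∑ p, ZMod.stdAddChar (A.phase p) else 0 := by
  rw [LinearMap.trace_eq_matrix_trace ℂ (Pi.basisFun ℂ _), Matrix.trace]
  split_ifs with h
  · simp [toEnd_apply, h]
  · simp [toEnd_apply, h]

/-- A sum of `d` complex numbers of modulus 1 equals `d` only if each of them is 1. Hence the kernel
of the character is the kernel of the representation. -/
theorem eq_one_of_trace_eq (A : Mono a b)
    (h : LinearMap.trace ℂ _ (toEnd A) = LinearMap.trace ℂ _ (toEnd (1 : Mono a b))) :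
    A = 1 := by
  rw [trace_toEnd, trace_toEnd, if_pos shift_one] at h
  simp only [phase_one, AddChar.map_zero_eq_one, Finset.sum_const, nsmul_eq_mul, mul_one] at h
  split_ifs at h with hs
  · have hre : ∑ p, (1 - (ZMod.stdAddChar (A.phase p)).re) = 0 := by
      have := congrArg Complex.re h
      rw [Complex.re_sum, Complex.natCast_re] at this
      rw [Finset.sum_sub_distrib, this]
      simp
    have hnorm : ∀ p, ‖ZMod.stdAddChar (A.phase p)‖ = 1 := fun p ↦ by
      rw [ZMod.stdAddChar_apply]; exact Circle.norm_coe _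
    have hle : ∀ p, (ZMod.stdAddChar (A.phase p)).re ≤ 1 := fun p ↦
      (Complex.re_le_norm _).trans_eq (hnorm p)
    have hp := (Finset.sum_eq_zero_iff_of_nonneg fun p _ ↦ sub_nonneg.mpr (hle p)).mp hre
    refine Mono.ext hs (funext fun p ↦ ?_)
    have h1 : (ZMod.stdAddChar (A.phase p)).re = 1 := by linarith [hp p (Finset.mem_univ p)]
    have h2 : ZMod.stdAddChar (A.phase p) = 1 := by
      have := (Complex.re_eq_norm.mp (h1.trans (hnorm p).symm))
      rw [Complex.eq_coe_norm_of_nonneg this, hnorm]; rfl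
    exact ZMod.injective_stdAddChar (h2.trans (AddChar.map_zero_eq_one _).symm)
  · exact absurd h.symm (Nat.cast_ne_zero.mpr Fintype.card_ne_zero)

/-- How often the eighth root of unity `ζ ^ e` occurs on the diagonal. -/
def count (A : Mono a b) (e : ZMod 8) : ℕ :=
  if A.shift = 0 then (Finset.univ.filter fun p ↦ A.phase p = e).card else 0

theorem trace_toEnd_eq_sum_count (A : Mono a b) :
    LinearMap.trace ℂ _ (toEnd A) = ∑ e, (A.count e : ℂ) * ZMod.stdAddChar e := by
  rw [trace_toEnd]
  unfold count
  split_ifs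
  · rw [← Finset.sum_fiberwise (s := Finset.univ) (g := A.phase)]
    refine Finset.sum_congr rfl fun e _ ↦ ?_
    rw [Finset.sum_congr rfl (g := fun _ ↦ ZMod.stdAddChar e), Finset.sum_const, nsmul_eq_mul]
    intro p hp
    rw [(Finset.mem_filter.mp hp).2]
  · simp

/-- The diagonal entries, encoded as the sum of `1024 ^ e` over the diagonal entries `ζ ^ e`. -/
def code (A : Mono a b) : ℕ :=
  if A.shift.1.val + A.shift.2.val = 0 then ∑ p, 2 ^ (10 * (A.phase p).val) else 0

theorem shift_eq_zero_iff (A : Mono a b) : A.shift.1.val + A.shift.2.val = 0 ↔ A.shift = 0 := by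
  rw [Prod.ext_iff, Fin.ext_iff, Fin.ext_iff]
  simp

theorem code_eq_sum_count (A : Mono a b) :
    A.code = ∑ e, A.count e * 2 ^ (10 * e.val) := by
  simp only [code, count, shift_eq_zero_iff]
  split_ifs
  · rw [← Finset.sum_fiberwise (s := Finset.univ) (g := A.phase)]
    refine Finset.sum_congr rfl fun e _ ↦ ?_
    rw [Finset.sum_congr rfl (g := fun _ ↦ 2 ^ (10 * e.val)), Finset.sum_const, smul_eq_mul]
    intro p hp
    rw [(Finset.mem_filter.mp hp).2]
  · simp

theorem count_le (A : Mono a b) (e : ZMod 8) : A.count e ≤ (a + 1) * (b + 1) := by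
  unfold count
  split_ifs
  · exact (Finset.card_le_univ _).trans_eq (by simp)
  · exact Nat.zero_le _

theorem code_one : (1 : Mono a b).code = (a + 1) * (b + 1) := by
  simp [code]

/-- Each diagonal entry contributes at least 1 to the code, with equality only for phase 0; a
nonzero shift has code 0. -/
theorem code_eq_iff (A : Mono a b) : A.code = (a + 1) * (b + 1) ↔ A = 1 := by
  refine ⟨fun h ↦ ?_, fun h ↦ by rw [h, code_one]⟩
  simp only [code, shift_eq_zero_iff] at h
  split_ifs at h with hs
  · have h1 : ∑ p : Fin (a + 1) × Fin (b + 1), 1 = ∑ p, 2 ^ (10 * (A.phase p).val) := by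
      rw [h]; simp
    rw [Finset.sum_eq_sum_iff_of_le fun p _ ↦ Nat.one_le_two_pow] at h1
    refine Mono.ext hs (funext fun p ↦ (ZMod.val_eq_zero _).mp ?_)
    have := h1 p (Finset.mem_univ p)
    rw [eq_comm, Nat.pow_eq_one] at this
    omega

theorem shift_pow (A : Mono a b) (n : ℕ) : (A ^ n).shift = n • A.shift := by
  induction n with
  | zero => simp
  | succ n ih => rw [pow_succ, shift_mul, ih, succ_nsmul]

/-- An expression for `(A * B).code`, for `B` diagonal, that is quick to evaluate. -/
def codeMul (A B : Mono a b) : ℕ :=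
  bif (A.shift.1.val.add A.shift.2.val).beq 0 then
    ∑ p, Nat.pow 2 (Nat.mul 10 (((A.phase p).val.add (B.phase p).val).mod 8)) else 0

theorem code_mul (A : Mono a b) {B : Mono a b} (hB : B.shift = 0) :
    (A * B).code = codeMul A B := by
  rw [code, codeMul, shift_mul, hB, add_zero, cond_eq_ite]
  split_ifs with h h' h'
  · rw [shift_eq_zero_iff] at h
    refine Finset.sum_congr rfl fun p _ ↦ ?_
    rw [phase_mul, h, add_zero, ZMod.val_add]
    rfl
  · exact absurd (by rw [Nat.beq_eq]; exact h) h'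
  · exact absurd (Nat.eq_of_beq_eq_true h') h
  · rfl

/-- The representation of `G` on `ℂⁿ` given by a homomorphism into the monomial matrices. -/
noncomputable def rep {G : Type*} [Group G] (φ : G →* Mono a b) :
    Representation ℂ G (Fin ((a + 1) * (b + 1)) → ℂ) :=
  (LinearEquiv.funCongrLeft ℂ ℂ finProdFinEquiv.symm).conjRingEquiv.toRingHom.toMonoidHom.comp
    (toEnd.comp φ)

theorem character_rep {G : Type*} [Group G] (φ : G →* Mono a b) (g : G) :
    (rep φ).character g = LinearMap.trace ℂ _ (toEnd (φ g)) :=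
  LinearMap.trace_conj' (toEnd (φ g)) (LinearEquiv.funCongrLeft ℂ ℂ finProdFinEquiv.symm)

theorem charKer_rep {G : Type*} [Group G] (φ : G →* Mono a b) :
    charKer (rep φ).character = {g | φ g = 1} := by
  ext g
  simp only [charKer, Set.mem_ofPred_eq, character_rep, map_one]
  exact ⟨fun h ↦ eq_one_of_trace_eq _ (by simpa using h), fun h ↦ by rw [h, map_one]⟩

end Mono

/-! ### An integer test for vanishing character sums. -/

theorem ZMod.stdAddChar_eight_add_four (e : ZMod 8) :
    ZMod.stdAddChar (e + 4) = -ZMod.stdAddChar e := by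
  have h : ZMod.stdAddChar (4 : ZMod 8) = (-1 : ℂ) := by
    have h1 : ZMod.stdAddChar (4 : ZMod 8) * ZMod.stdAddChar (4 : ZMod 8) = (1 : ℂ) := by
      rw [← AddChar.map_add_eq_mul, show (4 : ZMod 8) + 4 = 0 from by decide,
        AddChar.map_zero_eq_one]
    refine (mul_self_eq_one_iff.mp h1).resolve_left fun h2 ↦ ?_
    have := ZMod.injective_stdAddChar (h2.trans (AddChar.map_zero_eq_one _).symm)
    exact absurd this (by decide)
  rw [AddChar.map_add_eq_mul, h, mul_neg_one]

/-- The base `1024` digits `e` and `e + 4` of `n` agree for `e < 4`. -/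
def DigitBalanced (n : ℕ) : Prop := n / 2 ^ 40 = n % 2 ^ 40

instance : DecidablePred DigitBalanced := fun n ↦
  inferInstanceAs (Decidable (n / 2 ^ 40 = n % 2 ^ 40))

/-- The bound excludes carries, so the base 1024 digits recover `T`, and balance means `T e = T (e +
4)`. -/
theorem sum_mul_stdAddChar_eq_zero (T : ZMod 8 → ℕ) (hT : ∀ e, T e < 2 ^ 10)
    (h : DigitBalanced (∑ e, T e * 2 ^ (10 * e.val))) :
    ∑ e, (T e : ℂ) * ZMod.stdAddChar e = 0 := by
  have h4 : ∀ e, T e = T (e + 4) := by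
    have hs : ∑ e, T e * 2 ^ (10 * e.val) = T 0 + T 1 * 2 ^ 10 + T 2 * 2 ^ 20 + T 3 * 2 ^ 30 +
        T 4 * 2 ^ 40 + T 5 * 2 ^ 50 + T 6 * 2 ^ 60 + T 7 * 2 ^ 70 :=
      (Fin.sum_univ_eight fun e : Fin 8 ↦ T e * 2 ^ (10 * e.val)).trans (by norm_num; rfl)
    rw [hs] at h
    unfold DigitBalanced at h
    have h0 := hT 0; have h1 := hT 1; have h2 := hT 2; have h3 := hT 3
    have h4 := hT 4; have h5 := hT 5; have h6 := hT 6; have h7 := hT 7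
    have hlohi : T 0 + T 1 * 2 ^ 10 + T 2 * 2 ^ 20 + T 3 * 2 ^ 30 =
        T 4 + T 5 * 2 ^ 10 + T 6 * 2 ^ 20 + T 7 * 2 ^ 30 := by
      generalize hlo : T 0 + T 1 * 2 ^ 10 + T 2 * 2 ^ 20 + T 3 * 2 ^ 30 = lo at h
      generalize hhi : T 4 + T 5 * 2 ^ 10 + T 6 * 2 ^ 20 + T 7 * 2 ^ 30 = hi
      have : lo + T 4 * 2 ^ 40 + T 5 * 2 ^ 50 + T 6 * 2 ^ 60 + T 7 * 2 ^ 70 =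
        lo + hi * 2 ^ 40 := by rw [← hhi]; ring
      rw [this] at h
      omega
    have e0 : T 0 = T 4 := by omega
    have e1 : T 1 = T 5 := by omega
    have e2 : T 2 = T 6 := by omega
    have e3 : T 3 = T 7 := by omega
    intro e
    change Fin 8 at e
    fin_cases e
    exacts [e0, e1, e2, e3, e0.symm, e1.symm, e2.symm, e3.symm]
  -- Translation by 4 preserves `T` and negates the character, so the sum equals its own negative.
  have h1 : ∑ e, (T e : ℂ) * ZMod.stdAddChar e = -∑ e, (T e : ℂ) * ZMod.stdAddChar e := by
    rw [← Finset.sum_neg_distrib]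
    refine Fintype.sum_equiv (Equiv.addRight 4) _ _ fun e ↦ ?_
    rw [Equiv.coe_addRight, ZMod.stdAddChar_eight_add_four, ← h4]
    ring
  exact CharZero.eq_neg_self_iff.mp h1

/-- The pseudo-algebra of a group with a family of monomial representations, from data on a
parametrization `w` of its elements. -/
theorem pseudoAlgebra_of_mono {G W ι : Type*} [Group G] [Fintype W] [Fintype ι]
    (w : W ≃ G) {a b : ι → ℕ} (φ : ∀ j, G →* Mono (a j) (b j)) (w₀ : W) (hw₀ : w w₀ = 1)
    (hcard : ∑ j, ((a j + 1) * (b j + 1)) ^ 2 = Fintype.card W) (hlt : Fintype.card W < 2 ^ 10)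
    (hreg : ∀ x, x ≠ w₀ → DigitBalanced (∑ j, (a j + 1) * (b j + 1) * (φ j (w x)).code))
    (D : ι → ℕ)
    (hD : ∀ j, (∑ x, if (φ j (w x)).code = (a j + 1) * (b j + 1) then 1 else 0) *
      ((a j + 1) * (b j + 1) * D j) = Fintype.card W) :
    pseudoAlgebra G =
      {q | ∃ d ∈ Set.range D, q = ((d : ℂ), (Finset.univ.filter fun j ↦ D j = d).card)} := by
  classical
  have : Finite G := Finite.of_equiv W w
  have hG : Nat.card G = Fintype.card W := by
    rw [← Nat.card_congr w, Nat.card_eq_fintype_card]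
  refine pseudoAlgebra_of_regular (ρ := fun j ↦ Mono.rep (φ j)) (fun j ↦ by positivity) ?_ D ?_
  · intro g
    obtain ⟨x, rfl⟩ := w.surjective g
    split_ifs with hx
    · rw [hx, hG, ← hcard]
      simp [sq]
    · simp_rw [Mono.character_rep, Mono.trace_toEnd_eq_sum_count, Finset.mul_sum, ← mul_assoc]
      rw [Finset.sum_comm]
      simp_rw [← Finset.sum_mul]
      have hb := hreg x fun h ↦ hx (by rw [h, hw₀])
      simp_rw [Mono.code_eq_sum_count, Finset.mul_sum, ← mul_assoc] at hb
      rw [Finset.sum_comm] at hb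
      simp_rw [← Finset.sum_mul] at hb
      have := sum_mul_stdAddChar_eq_zero _ (fun e ↦ ?_) hb
      · push_cast at this ⊢
        exact this
      -- Each digit is at most the sum of the squared degrees, which is the group order and lies
      -- below 1024.
      · refine lt_of_le_of_lt (Finset.sum_le_sum fun j _ ↦ ?_) (hcard.trans_lt hlt)
        rw [sq]
        exact Nat.mul_le_mul_left _ (Mono.count_le _ _)
  · intro j
    rw [Mono.charKer_rep, hG, ← hD j]
    congr 1
    rw [← Finset.card_filter,
      ← Nat.card_congr (w.subtypeEquiv (p := fun x ↦ φ j (w x) = 1) (fun _ ↦ Iff.rfl)),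
      Nat.card_eq_fintype_card, Fintype.card_subtype]
    simp_rw [Mono.code_eq_iff]

/-! ### Explicit irreducible representations and their codegrees. -/

/-- Parameters of the normal forms `xⁱ yʲ zᵏ cˡ uᵐ vⁿ`. -/
abbrev Word : Type := Fin 2 × Fin 2 × Fin 2 × Fin 4 × Fin 2 × Fin 2

/-- The normal form `xⁱ yʲ zᵏ cˡ uᵐ vⁿ` in a group with six chosen elements. -/
def normalForm {G : Type*} [Monoid G] (g : Fin 6 → G) (i j k l m n : ℕ) : G :=
  (g 0 ^ i * g 1 ^ j * g 2 ^ k) * (g 3 ^ l * g 4 ^ m * g 5 ^ n)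

/-- The group element with normal form `w`. -/
def Word.eval {G : Type*} [Monoid G] (g : Fin 6 → G) (w : Word) : G :=
  normalForm g w.1 w.2.1 w.2.2.1 w.2.2.2.1 w.2.2.2.2.1 w.2.2.2.2.2

/-- The parameters `(α, β, γ)` with `c ^ (2 * α) * u ^ β * v ^ γ` equal to `x²`, `y²`, `z²`. -/
def squareExp : Fin 10 → Fin 3 → ℕ × ℕ × ℕ :=
  ![![(0, 0, 1), (0, 0, 0), (0, 0, 1)],
    ![(0, 0, 0), (0, 0, 1), (0, 0, 1)],
    ![(0, 0, 1), (0, 1, 0), (0, 0, 1)],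
    ![(0, 0, 0), (0, 1, 1), (0, 0, 1)],
    ![(1, 0, 0), (0, 0, 1), (0, 0, 1)],
    ![(1, 0, 1), (0, 1, 0), (0, 0, 1)],
    ![(1, 0, 0), (0, 1, 1), (0, 0, 1)],
    ![(1, 0, 0), (0, 0, 1), (0, 1, 0)],
    ![(1, 1, 1), (0, 0, 0), (0, 1, 0)],
    ![(1, 0, 0), (1, 1, 1), (0, 0, 1)]]

/-- Labels of the 32 irreducible characters: 8 linear ones, 14 of degree 2 with `c²` in the kernel,
8 faithful on `⟨c⟩` of degree 2, and 2 of degree 4. -/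
abbrev Idx : Type := Fin 8 ⊕ (Fin 7 × Fin 2) ⊕ Fin 8 ⊕ Fin 2

/-- The irreducible representation labelled `j` has degree `(dimA j + 1) * (dimB j + 1)`. -/
def dimA : Idx → ℕ
  | .inl _ => 0
  | .inr _ => 1

/-- See `dimA`. -/
def dimB : Idx → ℕ
  | .inr (.inr (.inr _)) => 1
  | _ => 0

/-- The `k`-th binary digit. -/
def digit (k n : ℕ) : ℕ := n / 2 ^ k % 2

/-- The monomial matrix with shift `s` and phases `f`. -/
def Mono.of {a b : ℕ} (s t : ℕ) (f : ℕ → ℕ → ℕ) : Mono a b :=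
  ⟨(Fin.ofNat _ s, Fin.ofNat _ t), fun p ↦ Fin.ofNat 8 (f p.1 p.2)⟩

/-- The exponent of `-1` in the value at `c ^ (2 * α) * u ^ β * v ^ γ` of the character of
`⟨c², u, v⟩` with parameters `ε, μ, ν`. -/
def pairing (q : ℕ × ℕ × ℕ) (ε μ ν : ℕ) : ℕ := (q.1 * ε + q.2.1 * μ + q.2.2 * ν) % 2

/-- A scalar multiple of a Pauli matrix, of square `(-1) ^ r`. -/
def pauli (s t r sign : ℕ) : Mono 1 0 :=
  .of s 0 fun j _ ↦ 2 * (r + s * t) + 4 * sign + 4 * t * j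

/-- Images of the generators in the linear characters. -/
def linGens (m : ℕ) : Fin 6 → Mono 0 0 :=
  ![.of 0 0 fun _ _ ↦ 4 * digit 0 m, .of 0 0 fun _ _ ↦ 4 * digit 1 m,
    .of 0 0 fun _ _ ↦ 4 * digit 2 m, 1, 1, 1]

/-- Images of the generators in the representations of degree 2 with `c²` in the kernel. -/
def pauliGens (q : Fin 3 → ℕ × ℕ × ℕ) (c u v s : ℕ) : Fin 6 → Mono 1 0 :=
  let r k := pairing (q k) 0 u v
  let sc n : Mono 1 0 := .of 0 0 fun _ _ ↦ 4 * n
  -- The signs `c, u, v` prescribe which pairs of generators anticommute. One anticommuting pair is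
  -- sent to the two basic Pauli matrices; the third generator is then determined up to the sign
  -- `s`.
  if c = 1 then
    ![pauli 1 0 (r 0) 0, pauli 0 1 (r 1) 0, pauli v u (r 2) s, sc c, sc u, sc v]
  else if u = 1 then
    ![pauli 1 0 (r 0) 0, pauli v 0 (r 1) s, pauli 0 1 (r 2) 0, sc c, sc u, sc v]
  else
    ![pauli 0 0 (r 0) s, pauli 1 0 (r 1) 0, pauli 0 1 (r 2) 0, sc c, sc u, sc v]

/-- Images of the generators in the representations of degree 2 that are faithful on `⟨c⟩`. -/
def dihedralGens (q : Fin 3 → ℕ × ℕ × ℕ) (u s t : ℕ) : Fin 6 → Mono 1 0 :=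
  let r k := pairing (q k) 1 u u
  -- The condition on `y²` reads `2 * e + 4 * r 0 + 6 = 4 * r 1` modulo 8; `s` selects one of its
  -- two solutions.
  let e := 2 * r 1 + 6 * r 0 + 1 + 4 * s
  ![.of 1 0 fun j _ ↦ 4 * r 0 * j,
    .of 1 0 fun j _ ↦ e + (4 * r 0 + 6) * j,
    .of 0 0 fun j _ ↦ 2 * r 2 + 4 * t + 4 * u * j,
    .of 0 0 fun j _ ↦ 2 + 4 * j, .of 0 0 fun _ _ ↦ 4 * u, .of 0 0 fun _ _ ↦ 4 * u]

/-- Images of the generators in the representations of degree 4. -/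
def quarticGens (q : Fin 3 → ℕ × ℕ × ℕ) (u : ℕ) : Fin 6 → Mono 1 1 :=
  let v := 1 - u
  let r k := pairing (q k) 1 u v
  let e := 2 * r 1 + 6 * r 0 + 1
  ![.of 1 u fun j _ ↦ 4 * r 0 * j,
    .of 1 v fun j _ ↦ e + (4 * r 0 + 6) * j,
    .of 0 0 fun _ j ↦ 2 * r 2 + 4 * j,
    .of 0 0 fun j _ ↦ 2 + 4 * j, .of 0 0 fun _ _ ↦ 4 * u, .of 0 0 fun _ _ ↦ 4 * v]

/-- The images of the generators in the irreducible representations. -/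
def gens (q : Fin 3 → ℕ × ℕ × ℕ) : ∀ j : Idx, Fin 6 → Mono (dimA j) (dimB j)
  | .inl m => linGens m
  | .inr (.inl (m, s)) => pauliGens q (digit 0 (m + 1)) (digit 1 (m + 1)) (digit 2 (m + 1)) s
  | .inr (.inr (.inl m)) => dihedralGens q (digit 0 m) (digit 1 m) (digit 2 m)
  | .inr (.inr (.inr u)) => quarticGens q u

/-- The codegrees of the irreducible characters. -/
def cod (q : Fin 3 → ℕ × ℕ × ℕ) : Idx → ℕ
  | .inl m => if m = 0 then 1 else 2
  | .inr (.inl (m, _)) =>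
    let c := digit 0 (m + 1)
    let u := digit 1 (m + 1)
    let v := digit 2 (m + 1)
    -- The element `x ^ v * y ^ u * z ^ c` acts as a scalar, and the parity is the exponent of `-1`
    -- in its square. If it is even, the scalar is `±1` and the image has order 8; otherwise the
    -- scalar is `±i` and the image has order 16.
    4 + 4 * ((pairing (q 0) 0 u v * v + pairing (q 1) 0 u v * u + pairing (q 2) 0 u v * c +
      c * u * v) % 2)
  | _ => 8

/-- The six elements satisfy the defining relations. -/
def IsSol {G : Type*} [Group G] (q : Fin 3 → ℕ × ℕ × ℕ) (g : Fin 6 → G) : Prop :=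
  let n k := g 3 ^ (2 * (q k).1) * g 4 ^ (q k).2.1 * g 5 ^ (q k).2.2
  g 1 * g 0 = g 0 * g 1 * g 3 ∧ g 2 * g 0 = g 0 * g 2 * g 4 ∧ g 2 * g 1 = g 1 * g 2 * g 5 ∧
  g 3 ^ 4 = 1 ∧ g 4 ^ 2 = 1 ∧ g 5 ^ 2 = 1 ∧
  g 3 * g 0 * g 3 = g 0 ∧ g 3 * g 1 * g 3 = g 1 ∧ g 3 * g 2 = g 2 * g 3 ∧
  (∀ k, g 4 * g k = g k * g 4) ∧ (∀ k, g 5 * g k = g k * g 5) ∧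
  g 0 ^ 2 = n 0 ∧ g 1 ^ 2 = n 1 ∧ g 2 ^ 2 = n 2

instance {G : Type*} [Group G] [DecidableEq G] (q : Fin 3 → ℕ × ℕ × ℕ) (g : Fin 6 → G) :
  Decidable (IsSol q g) := by unfold IsSol; infer_instance

theorem isSol_gens (i : Fin 10) (j : Idx) : IsSol (squareExp i) (gens (squareExp i) j) := by
  revert j
  fin_cases i <;> decide +kernel

/-- The number `(normalForm g i j k l m n).code`. -/
def normalFormCode {a b : ℕ} (g : Fin 6 → Mono a b) (i j k l m n : ℕ) : ℕ :=
  Mono.codeMul (g 0 ^ i * g 1 ^ j * g 2 ^ k) (g 3 ^ l * g 4 ^ m * g 5 ^ n)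

theorem shift_gens (q : Fin 3 → ℕ × ℕ × ℕ) (s : Idx) :
    (gens q s 3).shift = 0 ∧ (gens q s 4).shift = 0 ∧ (gens q s 5).shift = 0 := by
  obtain s | ⟨r, s⟩ | s | s := s
  · exact ⟨rfl, rfl, rfl⟩
  · simp only [gens, pauliGens]
    split_ifs <;> exact ⟨rfl, rfl, rfl⟩
  · exact ⟨rfl, rfl, rfl⟩
  · exact ⟨rfl, rfl, rfl⟩

theorem code_normalForm (q : Fin 3 → ℕ × ℕ × ℕ) (s : Idx) (i j k l m n : ℕ) :
    (normalForm (gens q s) i j k l m n).code = normalFormCode (gens q s) i j k l m n := by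
  refine Mono.code_mul _ ?_
  obtain ⟨h3, h4, h5⟩ := shift_gens q s
  simp [Mono.shift_pow, h3, h4, h5]

-- This is the vanishing of the weighted character sum at every nontrivial normal form.
set_option maxHeartbeats 4000000 in
theorem digitBalanced_sum_normalFormCode (t : Fin 10) :
    ∀ (i j k : Fin 2) (l : Fin 4) (m n : Fin 2), i.val + j + k + l + m + n = 0 ∨
      DigitBalanced (∑ s : Idx, (dimA s + 1) * (dimB s + 1) *
        normalFormCode (gens (squareExp t) s) i j k l m n) := by
  fin_cases t <;> decide +kernel

set_option maxHeartbeats 4000000 in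
theorem sum_normalFormCode_mul_cod (t : Fin 10) : ∀ s : Idx,
    (∑ i : Fin 2, ∑ j : Fin 2, ∑ k : Fin 2, ∑ l : Fin 4, ∑ m : Fin 2, ∑ n : Fin 2,
      if normalFormCode (gens (squareExp t) s) i j k l m n = (dimA s + 1) * (dimB s + 1)
        then 1 else 0) * ((dimA s + 1) * (dimB s + 1) * cod (squareExp t) s) = 128 := by
  fin_cases t <;> decide +kernel

theorem digitBalanced_sum_code (t : Fin 10) (i j k : Fin 2) (l : Fin 4) (m n : Fin 2) :
    i.val + j + k + l + m + n = 0 ∨ DigitBalanced (∑ s : Idx, (dimA s + 1) * (dimB s + 1) *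
      (normalForm (gens (squareExp t) s) i j k l m n).code) := by
  simp_rw [code_normalForm]
  exact digitBalanced_sum_normalFormCode t i j k l m n

theorem sum_kernel_mul_cod (t : Fin 10) (s : Idx) :
    (∑ i : Fin 2, ∑ j : Fin 2, ∑ k : Fin 2, ∑ l : Fin 4, ∑ m : Fin 2, ∑ n : Fin 2,
      if (normalForm (gens (squareExp t) s) i j k l m n).code = (dimA s + 1) * (dimB s + 1)
        then 1 else 0) * ((dimA s + 1) * (dimB s + 1) * cod (squareExp t) s) = 128 := by
  simp_rw [code_normalForm]
  exact sum_normalFormCode_mul_cod t s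

theorem cod_mem : ∀ (t : Fin 10) (s : Idx), cod (squareExp t) s ∈ [1, 2, 4, 8] := by
  decide +kernel

/-- Four of the seven sign triples `(c, u, v)` give codegree 4, each for two characters. The other
six characters of that family join the ten that are nontrivial on `c²`, making 16 of codegree 8. -/
theorem card_cod : ∀ t : Fin 10,
    (Finset.univ.filter fun s ↦ cod (squareExp t) s = 1).card = 1 ∧
    (Finset.univ.filter fun s ↦ cod (squareExp t) s = 2).card = 7 ∧
    (Finset.univ.filter fun s ↦ cod (squareExp t) s = 4).card = 8 ∧
    (Finset.univ.filter fun s ↦ cod (squareExp t) s = 8).card = 16 := by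
  decide +kernel

/-! ### Every element has a normal form. -/

section NormalForm

open scoped Pointwise

variable {G : Type*} [Group G] {q : Fin 3 → ℕ × ℕ × ℕ} {g : Fin 6 → G}

theorem exists_pow_eq_of_mem_closure (h : IsSol q g) {a : G}
    (ha : a ∈ Subgroup.closure {g 3, g 4, g 5}) :
    ∃ (l : Fin 4) (m n : Fin 2), a = g 3 ^ l.val * g 4 ^ m.val * g 5 ^ n.val := by
  obtain ⟨-, -, -, hc, hu, hv, -, -, -, hu', hv', -⟩ := h
  suffices h' : ∃ l m n : ℕ, a = g 3 ^ l * g 4 ^ m * g 5 ^ n by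
    obtain ⟨l, m, n, rfl⟩ := h'
    refine ⟨⟨l % 4, Nat.mod_lt _ (by norm_num)⟩, ⟨m % 2, Nat.mod_lt _ (by norm_num)⟩,
      ⟨n % 2, Nat.mod_lt _ (by norm_num)⟩, ?_⟩
    rw [← pow_eq_pow_mod _ hc, ← pow_eq_pow_mod _ hu, ← pow_eq_pow_mod _ hv]
  have h43 : ∀ m l : ℕ, Commute (g 4 ^ m) (g 3 ^ l) := fun m l ↦ Commute.pow_pow (hu' 3) _ _
  have h53 : ∀ m l : ℕ, Commute (g 5 ^ m) (g 3 ^ l) := fun m l ↦ Commute.pow_pow (hv' 3) _ _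
  have h54 : ∀ m l : ℕ, Commute (g 5 ^ m) (g 4 ^ l) := fun m l ↦ Commute.pow_pow (hv' 4) _ _
  have hmul : ∀ l m n l' m' n' : ℕ,
      g 3 ^ l * g 4 ^ m * g 5 ^ n * (g 3 ^ l' * g 4 ^ m' * g 5 ^ n') =
      g 3 ^ (l + l') * g 4 ^ (m + m') * g 5 ^ (n + n') := by
    intro l m n l' m' n'
    rw [pow_add, pow_add, pow_add]
    calc _ = g 3 ^ l * g 4 ^ m * (g 5 ^ n * g 3 ^ l') * g 4 ^ m' * g 5 ^ n' := by group
      _ = g 3 ^ l * (g 4 ^ m * g 3 ^ l') * (g 5 ^ n * g 4 ^ m') * g 5 ^ n' := by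
        rw [(h53 n l').eq]; group
      _ = _ := by rw [(h43 m l').eq, (h54 n m').eq]; group
  induction ha using Subgroup.closure_induction with
  | mem x hx =>
    rcases hx with rfl | rfl | rfl
    exacts [⟨1, 0, 0, by simp⟩, ⟨0, 1, 0, by simp⟩, ⟨0, 0, 1, by simp⟩]
  | one => exact ⟨0, 0, 0, by simp⟩
  | mul x y _ _ hx hy =>
    obtain ⟨l, m, n, rfl⟩ := hx
    obtain ⟨l', m', n', rfl⟩ := hy
    exact ⟨_, _, _, hmul ..⟩
  | inv x _ hx =>
    obtain ⟨l, m, n, rfl⟩ := hx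
    -- Since `c⁴ = u² = v² = 1`, inversion is the cube on `c` and the identity on `u` and `v`.
    refine ⟨3 * l, m, n, inv_eq_of_mul_eq_one_right ?_⟩
    rw [hmul, show l + 3 * l = 4 * l by ring, ← two_mul, ← two_mul, pow_mul, pow_mul, pow_mul, hc,
      hu, hv]
    simp

/-- Left multiplication by a generator preserves the set of normal forms. -/
theorem exists_normalForm_mul (h : IsSol q g) (t : Fin 6) (i j k : Fin 2) :
    ∃ i' j' k' : Fin 2, ∃ a ∈ Subgroup.closure {g 3, g 4, g 5},
      g t * (g 0 ^ i.val * g 1 ^ j.val * g 2 ^ k.val) =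
        g 0 ^ i'.val * g 1 ^ j'.val * g 2 ^ k'.val * a := by
  set K := Subgroup.closure {g 3, g 4, g 5} with hK
  have kc : g 3 ∈ K := Subgroup.subset_closure (by simp)
  have ku : g 4 ∈ K := Subgroup.subset_closure (by simp)
  have kv : g 5 ∈ K := Subgroup.subset_closure (by simp)
  obtain ⟨hyx, hzx, hzy, hc, hu, hv, hcx, hcy, hcz, hu', hv', hx2, hy2, hz2⟩ := h
  have hcx : g 3 * g 0 = g 0 * (g 3)⁻¹ := by rw [eq_mul_inv_iff_mul_eq, hcx]
  have hcy : g 3 * g 1 = g 1 * (g 3)⁻¹ := by rw [eq_mul_inv_iff_mul_eq, hcy]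
  have hc2 : (g 3 ^ 2)⁻¹ = g 3 ^ 2 := inv_eq_of_mul_eq_one_right (by rw [← pow_add, hc])
  -- The prescribed squares commute with `x, y, z, c`: `x` and `y` invert `c`, hence fix `c²`, which
  -- is its own inverse.
  have hn : ∀ k, ∀ s, Commute (g 3 ^ (2 * (q k).1) * g 4 ^ (q k).2.1 * g 5 ^ (q k).2.2)
      (g (Fin.castLE (by norm_num) (s : Fin 4))) := by
    intro k s
    refine Commute.mul_left (Commute.mul_left ?_ (Commute.pow_left (hu' _) _))
      (Commute.pow_left (hv' _) _)
    rw [pow_mul]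
    refine Commute.pow_left ?_ _
    have key : ∀ w, g 3 * w = w * (g 3)⁻¹ → Commute (g 3 ^ 2) w := by
      intro w hw
      have hw' : (g 3)⁻¹ * w = w * g 3 := by
        rw [inv_mul_eq_iff_eq_mul, ← mul_assoc, hw]; group
      rw [commute_iff_eq, sq, mul_assoc, hw, ← mul_assoc, hw, mul_assoc, ← mul_inv_rev, ← sq, hc2]
    fin_cases s
    exacts [key _ hcx, key _ hcy, Commute.pow_left hcz _, Commute.pow_left rfl _]
  have kn : ∀ k, g 3 ^ (2 * (q k).1) * g 4 ^ (q k).2.1 * g 5 ^ (q k).2.2 ∈ K := fun k ↦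
    K.mul_mem (K.mul_mem (K.pow_mem kc _) (K.pow_mem ku _)) (K.pow_mem kv _)
  beta_reduce at hx2 hy2 hz2
  have hn0 := hn 0; have hn1 := hn 1; have hn2 := hn 2
  have kn0 := kn 0; have kn1 := kn 1; have kn2 := kn 2
  clear hn kn
  generalize g 3 ^ (2 * (q 0).1) * g 4 ^ (q 0).2.1 * g 5 ^ (q 0).2.2 = n0 at *
  generalize g 3 ^ (2 * (q 1).1) * g 4 ^ (q 1).2.1 * g 5 ^ (q 1).2.2 = n1 at *
  generalize g 3 ^ (2 * (q 2).1) * g 4 ^ (q 2).2.1 * g 5 ^ (q 2).2.2 = n2 at *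
  have hZ : ∀ (a : G), Commute a (g 2) → Commute a (g 2 ^ k.val) := fun a ha ↦ ha.pow_right _
  have huX : Commute (g 4) (g 0 ^ i.val * g 1 ^ j.val) :=
    (Commute.pow_right (hu' 0) _).mul_right (Commute.pow_right (hu' 1) _)
  have hvX : Commute (g 5) (g 0 ^ i.val * g 1 ^ j.val) :=
    (Commute.pow_right (hv' 0) _).mul_right (Commute.pow_right (hv' 1) _)
  have hcXY : ∃ a ∈ K, Commute a (g 2) ∧
      g 3 * (g 0 ^ i.val * g 1 ^ j.val) = g 0 ^ i.val * g 1 ^ j.val * a := by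
    have hcz' : Commute (g 3)⁻¹ (g 2) := Commute.inv_left hcz
    have hcy' : (g 3)⁻¹ * g 1 = g 1 * g 3 := by
      rw [inv_mul_eq_iff_eq_mul, ← mul_assoc, hcy]; group
    fin_cases i <;> fin_cases j
    · exact ⟨g 3, kc, hcz, by simp⟩
    · exact ⟨(g 3)⁻¹, K.inv_mem kc, hcz', by simpa using hcy⟩
    · exact ⟨(g 3)⁻¹, K.inv_mem kc, hcz', by simpa using hcx⟩
    · refine ⟨g 3, kc, hcz, ?_⟩
      simp only [pow_one]
      rw [← mul_assoc, hcx, mul_assoc, hcy', mul_assoc]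
  have hzXY : g 2 * (g 0 ^ i.val * g 1 ^ j.val) =
      g 0 ^ i.val * g 1 ^ j.val * g 2 * (g 4 ^ i.val * g 5 ^ j.val) := by
    fin_cases i <;> fin_cases j
    · simp
    · simpa using hzy
    · simpa using hzx
    · simp only [pow_one]
      rw [← mul_assoc, hzx, mul_assoc, hu' 1, mul_assoc (g 0), ← mul_assoc (g 2), hzy]
      simp only [mul_assoc]
      rw [hv' 4]
  have hUV : Commute (g 4 ^ i.val * g 5 ^ j.val) (g 2) :=
    Commute.mul_left (Commute.pow_left (hu' 2) _) (Commute.pow_left (hv' 2) _)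
  have kUV : g 4 ^ i.val * g 5 ^ j.val ∈ K := K.mul_mem (K.pow_mem ku _) (K.pow_mem kv _)
  -- The difference `1 - a` in `Fin 2` toggles the exponent; a square splits off exactly when `a =
  -- 1`.
  have hsucc : ∀ t (a : Fin 2), g t * g t ^ a.val = g t ^ (1 - a).val * (g t ^ 2) ^ a.val := by
    intro t a
    fin_cases a <;> simp [sq]
  fin_cases t
  · refine ⟨1 - i, j, k, n0 ^ i.val, K.pow_mem kn0 _, ?_⟩
    have hcomm : Commute (n0 ^ i.val) (g 1 ^ j.val * g 2 ^ k.val) :=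
      (((hn0 1).pow_right _).mul_right ((hn0 2).pow_right _)).pow_left _
    calc g 0 * (g 0 ^ i.val * g 1 ^ j.val * g 2 ^ k.val)
        = g 0 * g 0 ^ i.val * (g 1 ^ j.val * g 2 ^ k.val) := by simp only [mul_assoc]
      _ = _ := by rw [hsucc, hx2, mul_assoc, hcomm.eq]; simp only [mul_assoc]
  -- Moving `y` past `xⁱ` produces `a = cⁱ`, and moving `a` past `yʲ` turns it into `b`, which is
  -- `a` or its inverse.
  · obtain ⟨a, ha, haz, hay, hX⟩ : ∃ a ∈ K, Commute a (g 2) ∧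
        (∃ b ∈ K, Commute b (g 2) ∧ a * g 1 ^ j.val = g 1 ^ j.val * b) ∧
        g 1 * g 0 ^ i.val = g 0 ^ i.val * g 1 * a := by
      fin_cases i
      · exact ⟨1, K.one_mem, Commute.one_left _, ⟨1, K.one_mem, Commute.one_left _, by simp⟩,
          by simp⟩
      · refine ⟨g 3, kc, hcz, ?_, by simpa using hyx⟩
        fin_cases j
        · exact ⟨g 3, kc, hcz, by simp⟩
        · exact ⟨(g 3)⁻¹, K.inv_mem kc, Commute.inv_left hcz, by simpa using hcy⟩
    obtain ⟨b, hb, hbz, hab⟩ := hay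
    refine ⟨i, 1 - j, k, n1 ^ j.val * b, K.mul_mem (K.pow_mem kn1 _) hb, ?_⟩
    have hcomm : Commute (n1 ^ j.val * b) (g 2 ^ k.val) :=
      (Commute.mul_left ((hn1 2).pow_left _) hbz).pow_right _
    calc g 1 * (g 0 ^ i.val * g 1 ^ j.val * g 2 ^ k.val)
        = g 1 * g 0 ^ i.val * g 1 ^ j.val * g 2 ^ k.val := by simp only [mul_assoc]
      _ = g 0 ^ i.val * (g 1 * g 1 ^ j.val) * b * g 2 ^ k.val := by
        rw [hX]; simp only [mul_assoc]; rw [← mul_assoc a, hab]; simp only [mul_assoc]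
      _ = g 0 ^ i.val * g 1 ^ (1 - j).val * ((n1 ^ j.val * b) * g 2 ^ k.val) := by
        rw [hsucc, hy2]; simp only [mul_assoc]
      _ = _ := by rw [hcomm.eq]; simp only [mul_assoc]
  · refine ⟨i, j, 1 - k, n2 ^ k.val * (g 4 ^ i.val * g 5 ^ j.val),
      K.mul_mem (K.pow_mem kn2 _) kUV, ?_⟩
    calc g 2 * (g 0 ^ i.val * g 1 ^ j.val * g 2 ^ k.val)
        = g 2 * (g 0 ^ i.val * g 1 ^ j.val) * g 2 ^ k.val := by simp only [mul_assoc]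
      _ = g 0 ^ i.val * g 1 ^ j.val * g 2 * ((g 4 ^ i.val * g 5 ^ j.val) * g 2 ^ k.val) := by
        rw [hzXY]; simp only [mul_assoc]
      _ = g 0 ^ i.val * g 1 ^ j.val * (g 2 * g 2 ^ k.val) * (g 4 ^ i.val * g 5 ^ j.val) := by
        rw [(hUV.pow_right _).eq]; simp only [mul_assoc]
      _ = _ := by rw [hsucc, hz2]; simp only [mul_assoc]
  · obtain ⟨a, ha, haz, hX⟩ := hcXY
    refine ⟨i, j, k, a, ha, ?_⟩
    calc _ = g 3 * (g 0 ^ i.val * g 1 ^ j.val) * g 2 ^ k.val := by simp only [mul_assoc]; rfl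
      _ = _ := by rw [hX, mul_assoc, (hZ a haz).eq]; simp only [mul_assoc]
  · exact ⟨i, j, k, g 4, ku, (huX.mul_right (hZ _ (hu' 2))).eq⟩
  · exact ⟨i, j, k, g 5, kv, (hvX.mul_right (hZ _ (hv' 2))).eq⟩

/-- The normal forms contain 1, and the stabilizer of their set under left multiplication contains
all generators, hence is the whole group. -/
theorem eval_surjective (h : IsSol q g) (htop : Subgroup.closure (Set.range g) = ⊤) :
    Function.Surjective (Word.eval g) := by
  have hS : ∀ a, a ∈ Set.range (Word.eval g) ↔ ∃ i j k : Fin 2,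
      ∃ b ∈ Subgroup.closure {g 3, g 4, g 5}, a = g 0 ^ i.val * g 1 ^ j.val * g 2 ^ k.val * b := by
    intro a
    constructor
    · rintro ⟨⟨i, j, k, l, m, n⟩, rfl⟩
      refine ⟨i, j, k, _, ?_, rfl⟩
      exact Subgroup.mul_mem _ (Subgroup.mul_mem _
        (Subgroup.pow_mem _ (Subgroup.subset_closure (by simp)) _)
        (Subgroup.pow_mem _ (Subgroup.subset_closure (by simp)) _))
        (Subgroup.pow_mem _ (Subgroup.subset_closure (by simp)) _)
    · rintro ⟨i, j, k, b, hb, rfl⟩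
      obtain ⟨l, m, n, rfl⟩ := exists_pow_eq_of_mem_closure h hb
      exact ⟨(i, j, k, l, m, n), rfl⟩
  have hstab : Subgroup.closure (Set.range g) ≤
      MulAction.stabilizer G (Set.range (Word.eval g)) := by
    rw [Subgroup.closure_le]
    rintro _ ⟨t, rfl⟩
    rw [SetLike.mem_coe, MulAction.mem_stabilizer_iff]
    -- Translation preserves cardinality and the set is finite, so one inclusion suffices.
    refine Set.eq_of_subset_of_ncard_le ?_ (Set.ncard_smul_set _ _).ge (Set.finite_range _)
    rintro _ ⟨a, ha, rfl⟩
    obtain ⟨i, j, k, b, hb, rfl⟩ := (hS a).mp ha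
    obtain ⟨i', j', k', a', ha', he⟩ := exists_normalForm_mul h t i j k
    refine (hS _).mpr ⟨i', j', k', a' * b, Subgroup.mul_mem _ ha' hb, ?_⟩
    simp only [smul_eq_mul]
    rw [← mul_assoc, he, mul_assoc]
  intro a
  have ha : a ∈ MulAction.stabilizer G (Set.range (Word.eval g)) :=
    hstab (htop ▸ Subgroup.mem_top a)
  rw [MulAction.mem_stabilizer_iff] at ha
  have h1 : (1 : G) ∈ Set.range (Word.eval g) :=
    ⟨(0, 0, 0, 0, 0, 0), by simp [Word.eval, normalForm]⟩
  have := Set.smul_mem_smul_set (a := a) h1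
  rw [ha, smul_eq_mul, mul_one] at this
  exact this

end NormalForm

/-! ### Uniqueness of normal forms, the order and the pseudo-algebra. -/

theorem pow_val_sub_mul_pow_val {G : Type*} [Monoid G] {n : ℕ} [NeZero n] {a : G}
    (ha : a ^ n = 1) (i j : Fin n) : a ^ (i - j).val * a ^ j.val = a ^ i.val := by
  rw [← pow_add, pow_eq_pow_mod _ ha, ← Fin.val_add, sub_add_cancel]

theorem eval_linGens_injective : ∀ i j k i' j' k' : Fin 2,
    (∀ m : Fin 8, normalForm (linGens m) i j k 0 0 0 = normalForm (linGens m) i' j' k' 0 0 0) →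
      i = i' ∧ j = j' ∧ k = k' := by
  decide +kernel

theorem map_normalForm {G H : Type*} [Monoid G] [Monoid H] (φ : G →* H) (g : Fin 6 → G)
    (i j k l m n : ℕ) : φ (normalForm g i j k l m n) = normalForm (φ ∘ g) i j k l m n := by
  simp [normalForm]

theorem sum_sq_dim : ∑ j : Idx, ((dimA j + 1) * (dimB j + 1)) ^ 2 = 128 := by
  decide +kernel

section Representations

variable {G : Type*} [Group G] {t : Fin 10} {g : Fin 6 → G}

/-- An element equal to 1 acts trivially everywhere, so its weighted code sum is 128. This is
unbalanced: digit 0 is 128 and digit 4 is 0. A nonzero `w` would make it balanced. -/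
theorem eq_zero_of_eval_eq_one (φ : ∀ j : Idx, G →* Mono (dimA j) (dimB j))
    (hφ : ∀ j, φ j ∘ g = gens (squareExp t) j) {w : Word} (hw : Word.eval g w = 1) : w = 0 := by
  obtain ⟨i, j, k, l, m, n⟩ := w
  rcases digitBalanced_sum_code t i j k l m n with h | h
  · have : i.val = 0 ∧ j.val = 0 ∧ k.val = 0 ∧ l.val = 0 ∧ m.val = 0 ∧ n.val = 0 := by omega
    simp only [Fin.val_eq_zero_iff] at this
    obtain ⟨rfl, rfl, rfl, rfl, rfl, rfl⟩ := this
    rfl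
  · exfalso
    have h1 : ∀ s, normalForm (gens (squareExp t) s) i j k l m n = 1 := by
      intro s
      rw [← hφ, ← map_normalForm, ← map_one (φ s), ← hw]
      rfl
    simp_rw [h1, Mono.code_one, ← sq, sum_sq_dim] at h
    revert h
    decide

/-- The linear characters separate the exponents of `x, y, z`. After cancellation only the commuting
elements `c, u, v` remain, so the quotient of two equal words is a normal form with the differences
as exponents, and the trivial kernel applies. -/
theorem eval_injective (h : IsSol (squareExp t) g) (φ : ∀ j : Idx, G →* Mono (dimA j) (dimB j))
    (hφ : ∀ j, φ j ∘ g = gens (squareExp t) j) : Function.Injective (Word.eval g) := by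
  rintro ⟨i, j, k, l, m, n⟩ ⟨i', j', k', l', m', n'⟩ he
  obtain ⟨rfl, rfl, rfl⟩ : i = i' ∧ j = j' ∧ k = k' := by
    refine eval_linGens_injective i j k i' j' k' fun r ↦ ?_
    have := congrArg (φ (.inl r)) he
    simp only [Word.eval, map_normalForm, hφ] at this
    change normalForm (linGens r) i j k l m n = normalForm (linGens r) i' j' k' l' m' n' at this
    simpa [normalForm, linGens] using this
  obtain ⟨-, -, -, hc, hu, hv, -, -, -, hu', hv', -⟩ := h
  have he : g 3 ^ l.val * g 4 ^ m.val * g 5 ^ n.val = g 3 ^ l'.val * g 4 ^ m'.val * g 5 ^ n'.val :=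
    mul_left_cancel he
  have h0 : ((0, 0, 0, l - l', m - m', n - n') : Word) = 0 := by
    refine eq_zero_of_eval_eq_one φ hφ ?_
    have h1 : Word.eval g (0, 0, 0, l - l', m - m', n - n') =
        g 3 ^ (l - l').val * g 4 ^ (m - m').val * g 5 ^ (n - n').val := by
      simp [Word.eval, normalForm]
    rw [h1, ← mul_eq_right (b := g 3 ^ l'.val * g 4 ^ m'.val * g 5 ^ n'.val)]
    refine Eq.trans ?_ he
    rw [← pow_val_sub_mul_pow_val hc l l', ← pow_val_sub_mul_pow_val hu m m',
      ← pow_val_sub_mul_pow_val hv n n']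
    have h53 : Commute (g 5 ^ (n - n').val) (g 3 ^ l'.val) := Commute.pow_pow (hv' 3) _ _
    have h54 : Commute (g 5 ^ (n - n').val) (g 4 ^ m'.val) := Commute.pow_pow (hv' 4) _ _
    have h43 : Commute (g 4 ^ (m - m').val) (g 3 ^ l'.val) := Commute.pow_pow (hu' 3) _ _
    simp only [mul_assoc]
    rw [h53.left_comm, h54.left_comm, h43.left_comm]
  simp only [Prod.ext_iff, Prod.fst_zero, Prod.snd_zero, sub_eq_zero, true_and] at h0
  obtain ⟨rfl, rfl, rfl⟩ := h0
  rfl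

theorem pseudoAlgebra_eq_of_cod {ι : Type*} [Fintype ι] {D : ι → ℕ}
    (hmem : ∀ s, D s ∈ [1, 2, 4, 8])
    (hcard : (Finset.univ.filter fun s ↦ D s = 1).card = 1 ∧
      (Finset.univ.filter fun s ↦ D s = 2).card = 7 ∧
      (Finset.univ.filter fun s ↦ D s = 4).card = 8 ∧
      (Finset.univ.filter fun s ↦ D s = 8).card = 16) :
    {q : ℂ × ℕ | ∃ d ∈ Set.range D, q = ((d : ℂ), (Finset.univ.filter fun s ↦ D s = d).card)} =
      {(1, 1), (2, 7), (4, 8), (8, 16)} := by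
  obtain ⟨h1, h2, h4, h8⟩ := hcard
  have hr : ∀ d, 0 < (Finset.univ.filter fun s ↦ D s = d).card → d ∈ Set.range D := by
    intro d hd
    obtain ⟨s, hs⟩ := Finset.card_pos.mp hd
    exact ⟨s, (Finset.mem_filter.mp hs).2⟩
  ext q
  constructor
  · rintro ⟨_, ⟨s, rfl⟩, rfl⟩
    have := hmem s
    simp only [List.mem_cons, List.not_mem_nil, or_false] at this
    rcases this with h | h | h | h <;> rw [h] <;> simp [h1, h2, h4, h8]
  · rintro (rfl | rfl | rfl | rfl)
    · exact ⟨1, hr 1 (by omega), by simp [h1]⟩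
    · exact ⟨2, hr 2 (by omega), by simp [h2]⟩
    · exact ⟨4, hr 4 (by omega), by simp [h4]⟩
    · exact ⟨8, hr 8 (by omega), by simp [h8]⟩

theorem card_and_pseudoAlgebra (h : IsSol (squareExp t) g)
    (htop : Subgroup.closure (Set.range g) = ⊤) (φ : ∀ j : Idx, G →* Mono (dimA j) (dimB j))
    (hφ : ∀ j, φ j ∘ g = gens (squareExp t) j) :
    Nat.card G = 128 ∧ pseudoAlgebra G = {(1, 1), (2, 7), (4, 8), (8, 16)} := by
  let e : Word ≃ G := Equiv.ofBijective _ ⟨eval_injective h φ hφ, eval_surjective h htop⟩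
  have hW : Fintype.card Word = 128 := by simp
  have hφe : ∀ j (w : Word), φ j (e w) = normalForm (gens (squareExp t) j)
      w.1 w.2.1 w.2.2.1 w.2.2.2.1 w.2.2.2.2.1 w.2.2.2.2.2 := by
    intro j w
    rw [← hφ, ← map_normalForm]
    rfl
  have hw₀ : Word.eval g 0 = 1 := by simp [Word.eval, normalForm]
  refine ⟨by rw [← Nat.card_congr e, Nat.card_eq_fintype_card, hW], ?_⟩
  rw [← pseudoAlgebra_eq_of_cod (cod_mem t) (card_cod t)]
  refine pseudoAlgebra_of_mono e φ 0 hw₀ (by rw [sum_sq_dim, hW])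
    (by rw [hW]; norm_num) ?_ _ ?_
  · rintro ⟨i, j, k, l, m, n⟩ hw
    simp_rw [hφe]
    refine (digitBalanced_sum_code t i j k l m n).resolve_left fun h0 ↦ hw ?_
    have : i.val = 0 ∧ j.val = 0 ∧ k.val = 0 ∧ l.val = 0 ∧ m.val = 0 ∧ n.val = 0 := by omega
    simp only [Fin.val_eq_zero_iff] at this
    obtain ⟨rfl, rfl, rfl, rfl, rfl, rfl⟩ := this
    rfl
  · intro s
    simp_rw [hφe, Fintype.sum_prod_type]
    rw [hW]
    exact sum_kernel_mul_cod t s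

end Representations

/-! ### From the presentation to solutions of the relations. -/

section Presentation

open Pres

theorem squares_eq (t : Fin 10) : squares t =
    (c ^ (2 * (squareExp t 0).1) * u ^ (squareExp t 0).2.1 * v ^ (squareExp t 0).2.2,
      c ^ (2 * (squareExp t 1).1) * u ^ (squareExp t 1).2.1 * v ^ (squareExp t 1).2.2,
      c ^ (2 * (squareExp t 2).1) * u ^ (squareExp t 2).2.1 * v ^ (squareExp t 2).2.2) := by
  fin_cases t <;> simp [squares, squareExp]

/-- Used in both directions: the matrices define homomorphisms out of `ExGroup t`, and its own
generators satisfy `IsSol`. -/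
theorem lift_rels_iff {G : Type*} [Group G] (t : Fin 10) (g : Fin 6 → G) :
    (∀ r ∈ rels (squares t).1 (squares t).2.1 (squares t).2.2, FreeGroup.lift g r = 1) ↔
      IsSol (squareExp t) g := by
  have h6 : ∀ P : Fin 6 → Prop, (∀ k, P k) ↔ P 0 ∧ P 1 ∧ P 2 ∧ P 3 ∧ P 4 ∧ P 5 := fun P ↦
    ⟨fun h ↦ ⟨h 0, h 1, h 2, h 3, h 4, h 5⟩, fun ⟨h0, h1, h2, h3, h4, h5⟩ k ↦ by
      fin_cases k <;> assumption⟩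
  have e1 : ∀ a b : G, a⁻¹ * b * a * b = 1 ↔ b * a * b = a := fun a b ↦ by
    rw [mul_assoc, mul_assoc, inv_mul_eq_one, eq_comm, mul_assoc]
  simp only [squares_eq, rels, Set.mem_insert_iff, Set.mem_singleton_iff, forall_eq_or_imp,
    forall_eq, map_mul, map_inv, map_pow, x, y, z, c, u, v, FreeGroup.lift_apply_of, IsSol, h6,
    mul_inv_eq_one, e1, true_and]
  constructor
  · rintro ⟨a1, a2, a3, a4, a5, a6, a7, a8, a9, a10, a11, a12, a13, a14, a15, a16, a17, a18, a19,
      a20, a21⟩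
    exact ⟨a1, a2, a3, a4, a5, a6, a7, a8, a9, ⟨a10, a11, a12, a13, a18⟩,
      ⟨a14, a15, a16, a17, a18.symm, trivial⟩, a19, a20, a21⟩
  · rintro ⟨a1, a2, a3, a4, a5, a6, a7, a8, a9, ⟨a10, a11, a12, a13, a18⟩,
      ⟨a14, a15, a16, a17, -⟩, a19, a20, a21⟩
    exact ⟨a1, a2, a3, a4, a5, a6, a7, a8, a9, a10, a11, a12, a13, a14, a15, a16, a17, a18, a19,
      a20, a21⟩

theorem card_and_pseudoAlgebra_exGroup (t : Fin 10) :
    Nat.card (ExGroup t) = 128 ∧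
      pseudoAlgebra (ExGroup t) = {(1, 1), (2, 7), (4, 8), (8, 16)} := by
  have hlift : FreeGroup.lift (PresentedGroup.of :
      Fin 6 → ExGroup t) = PresentedGroup.mk _ := by ext; simp [PresentedGroup.of]
  refine card_and_pseudoAlgebra (t := t) (g := PresentedGroup.of) ?_
    (PresentedGroup.closure_range_of _)
    (fun j ↦ PresentedGroup.toGroup ((lift_rels_iff t _).mpr (isSol_gens t j)))
    (fun j ↦ funext fun k ↦ PresentedGroup.toGroup.of _)
  refine (lift_rels_iff t _).mp fun r hr ↦ ?_
  rw [hlift]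
  exact PresentedGroup.one_of_mem hr

end Presentation

/-! ### The abelian group and its linear characters. -/

section Abelian

/-- The embedding of `ℤ/2` into `ℤ/8`. -/
def fourMul : ZMod 2 →+ ZMod 8 where
  toFun b := if b = 0 then 0 else 4
  map_zero' := rfl
  map_add' := by decide

/-- The linear characters of `C₈ × C₂ × C₂`. -/
def abChar (s : ZMod 8 × ZMod 2 × ZMod 2) : AbGroup →* Mono 0 0 where
  toFun a := ⟨0, fun _ ↦ s.1 * a.1.toAdd + fourMul (s.2.1 * a.2.1.toAdd) +
    fourMul (s.2.2 * a.2.2.toAdd)⟩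
  map_one' := by ext <;> simp
  map_mul' a b := by
    ext
    · simp
    · simp
    · simp only [Prod.fst_mul, Prod.snd_mul, toAdd_mul, mul_add, map_add, Mono.phase_mul]
      abel

/-- The codegrees of the linear characters of `C₈ × C₂ × C₂`. -/
def abCod (s : ZMod 8 × ZMod 2 × ZMod 2) : ℕ :=
  if s = 0 then 1 else if 2 * s.1 = 0 then 2 else if 4 * s.1 = 0 then 4 else 8

theorem pseudoAlgebra_abGroup : pseudoAlgebra AbGroup = {(1, 1), (2, 7), (4, 8), (8, 16)} := by
  rw [← pseudoAlgebra_eq_of_cod (D := abCod) (by decide +kernel) (by decide +kernel)]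
  refine pseudoAlgebra_of_mono (Equiv.refl AbGroup) (fun s ↦ abChar s) 1 rfl (by decide +kernel)
    (by decide +kernel) ?_ _ ?_
  · decide +kernel
  · decide +kernel

theorem card_abGroup : Nat.card AbGroup = 32 := by
  simp

end Abelian

theorem theorem1p1 :
    -- There are a prime `p`, an abelian `p`-group `A` and a group `G`, not isomorphic to `A` and
    -- even of another order, with `C(G) = C(A)`.
    (∃ (p : ℕ) (A G : Type) (_ : CommGroup A) (_ : Group G),
      p.Prime ∧ Finite A ∧ Finite G ∧ IsPGroup p A ∧
      pseudoAlgebra G = pseudoAlgebra A ∧ IsEmpty (G ≃* A) ∧ Nat.card G ≠ Nat.card A) ∧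
    -- Concretely, `A` can be `C₈ × C₂ × C₂`, and `G` any of ten explicit groups of order 128.
    (IsPGroup 2 AbGroup ∧ Nat.card AbGroup = 32 ∧
      pseudoAlgebra AbGroup = {(1, 1), (2, 7), (4, 8), (8, 16)} ∧
      ∀ i : Fin 10, Nat.card (ExGroup i) = 128 ∧
        pseudoAlgebra (ExGroup i) = pseudoAlgebra AbGroup ∧
        IsEmpty (ExGroup i ≃* AbGroup)) := by
  have hp : IsPGroup 2 AbGroup := IsPGroup.of_card (n := 5) (by rw [card_abGroup]; norm_num)
  have hne : ∀ i, Nat.card (ExGroup i) ≠ Nat.card AbGroup := fun i ↦ by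
    rw [(card_and_pseudoAlgebra_exGroup i).1, card_abGroup]; norm_num
  have hC : ∀ i, pseudoAlgebra (ExGroup i) = pseudoAlgebra AbGroup := fun i ↦
    (card_and_pseudoAlgebra_exGroup i).2.trans pseudoAlgebra_abGroup.symm
  have hiso : ∀ i, IsEmpty (ExGroup i ≃* AbGroup) := fun i ↦
    ⟨fun e ↦ hne i (Nat.card_congr e.toEquiv)⟩
  refine ⟨⟨2, AbGroup, ExGroup 0, inferInstance, inferInstance, Nat.prime_two, inferInstance,
    Nat.finite_of_card_ne_zero ?_, hp, hC 0, hiso 0, hne 0⟩, hp, card_abGroup,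
    pseudoAlgebra_abGroup, fun i ↦ ⟨(card_and_pseudoAlgebra_exGroup i).1, hC i, hiso i⟩⟩
  rw [(card_and_pseudoAlgebra_exGroup 0).1]
  norm_num
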